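/- Let $X$ be an integral separated scheme of finite type over a field $k$, and let $\mathcal I,\mathcal J\subseteq\mathcal O_X$ be coherent sheaves of ideals. For an ideal $I$ of a Noetherian ring $R$ and $f\in R$ put $$\mu_I(f)=\sup\Big\{\tfrac pq\in\mathbb Q_{\ge 0}\ \Big|\ f^q\in\overline{I^p}\Big\}\in[0,\infty],$$ where $p\ge 0$ and $q\ge 1$ are integers and $\overline{I^p}$ is the integral closure of the ideal $I^p$. For $x\in X$ put $$\mu_{\mathcal I}(\mathcal J)(x)=\inf_{f\in\mathcal J_x}\mu_{\mathcal I_x}(f).$$ Let $\Pi':X''\to X$ be a desingularization of $X$, i.e. a proper birational morphism with $X''$ non-singular (all its local rings are regular) that is an isomorphism over $X\setminus\mathrm{Sing}(X)$. Let $\Pi'':X'\to X''$ be a log-resolution of $\mathcal I\mathcal O_{X''}$, i.e. a proper birational morphism with $X'$ non-singular that is an isomorphism over the complement of $\mathrm{Supp}(\mathcal I\mathcal O_{X''})$ (the zero locus of the ideal), such that the preimage of $\mathrm{Supp}(\mathcal I\mathcal O_{X''})$ is a union $H_1\cup\dots\cup H_r$ of irreducible hypersurfaces with simple normal crossings (at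 every point of $X'$, the ideals of the $H_i$ passing through it are generated by distinct members of one regular system of parameters), and $$\mathcal I\mathcal O_{X'}=\mathbf I(H_1)^{a_1}\cdots\mathbf I(H_r)^{a_r}$$ with positive integers $a_1,\dots,a_r$; here $\mathbf I(H_i)$ is the ideal sheaf of $H_i$ with its reduced structure. Put $\Pi=\Pi'\circ\Pi'':X'\to X$, and suppose that $$\mathcal J\mathcal O_{X'}=\mathbf I(H_1)^{b_1}\cdots\mathbf I(H_r)^{b_r}\,\mathcal J',$$ where $b_1,\dots,b_r$ are non-negative integers and $\mathcal J'\subseteq\mathcal O_{X'}$ is a coherent sheaf of ideals with $\mathcal J'\not\subseteq\mathbf I(H_i)$ for all $i=1,\dots,r$. Define $\lambda:X'\to[0,\infty]$ by $$\lambda(x')=\min\Big\{\tfrac{b_i}{a_i}\ \Big|\ 1\le i\le r,\ x'\in H_i\Big\},$$ with $\lambda(x')=\infty$ if $x'$ lies on no $H_i$. Then for every $x\in X$ the set $\{\lambda(x')\mid x'\in\Pi^{-1}(x)\}$ has a minimum and $$\mu_{\mathcal I}(\mathcal J)(x)=\min\{\lambda(x')\mid x'\in\Pi^{-1}(x)\}.$$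 Moreover the function $\mu_{\mathcal I}(\mathcal J):X\to[0,\infty]$ is lower-semicontinuous, i.e. $\{x\in X\mid\mu_{\mathcal I}(\mathcal J)(x)\le\alpha\}$ is closed for every real $\alpha$. -/

import Mathlib

open AlgebraicGeometry CategoryTheory TopologicalSpace
open scoped ENNReal

universe u

noncomputable section

namespace ReducedOrder

/-! ### Integral closure of ideals and the order function of an ideal -/

/-- `f` lies in the integral closure of the ideal `I`: it satisfies an equation
`f ^ n + c₁ f ^ (n - 1) + ⋯ + cₙ = 0` with `n ≥ 1` and `cᵢ ∈ I ^ i`. -/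
def MemIntegralClosure {R : Type*} [CommRing R] (I : Ideal R) (f : R) : Prop :=
  ∃ n : ℕ, 0 < n ∧ ∃ c : ℕ → R, (∀ i ∈ Finset.Icc 1 n, c i ∈ I ^ i) ∧
    f ^ n + ∑ i ∈ Finset.Icc 1 n, c i * f ^ (n - i) = 0

/-- `μ_I(f)`: the supremum in `[0, ∞]` of the rationals `p / q` such that `f ^ q` lies in the
integral closure of `I ^ p`. -/
def mu {R : Type*} [CommRing R] (I : Ideal R) (f : R) : ℝ≥0∞ :=
  sSup {v : ℝ≥0∞ | ∃ p q : ℕ, 0 < q ∧ MemIntegralClosure (I ^ p) (f ^ q) ∧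
    v = (p : ℝ≥0∞) / (q : ℝ≥0∞)}

/-- `μ_I(J) = inf {μ_I(f) : f ∈ J}`. -/
def muIdeal {R : Type*} [CommRing R] (I J : Ideal R) : ℝ≥0∞ :=
  ⨅ f ∈ J, mu I f

/-! ### Sheaves of ideals on a scheme -/

/-- The stalk at `x` of a (quasi-coherent) sheaf of ideals, as an ideal of the local ring at `x`:
it is generated by the germs of the sections of the sheaf on affine neighbourhoods of `x`. -/
def stalkIdeal {X : Scheme.{u}} (I : X.IdealSheafData) (x : X) : Ideal (X.presheaf.stalk x) :=
  ⨆ (U : X.affineOpens) (hx : x ∈ U.1), (I.ideal U).map (X.presheaf.germ U.1 x hx).hom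

/-- The function `μ_I(J) : X → [0, ∞]` attached to two sheaves of ideals. -/
def muSheaf {X : Scheme.{u}} (I J : X.IdealSheafData) (x : X) : ℝ≥0∞ :=
  muIdeal (stalkIdeal I x) (stalkIdeal J x)

/-! ### Non-singular schemes, normal crossings, resolutions -/

/-- All local rings are regular. -/
def IsNonsingular (X : Scheme.{u}) : Prop :=
  ∀ x : X, IsRegularLocalRing (X.presheaf.stalk x)

/-- `f : X' ⟶ X` is a birational morphism: it restricts to an isomorphism between a dense open
subscheme of `X'` and a dense open subscheme of `X`. -/
def IsBirational {X' X : Scheme.{u}} (f : X' ⟶ X) : Prop :=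
  Scheme.BirationalOver f (𝟙 X)

/-- A desingularization: a proper birational morphism from a non-singular scheme which is an
isomorphism outside the singular locus, that is, over every open set of regular points. -/
structure IsDesingularization {X' X : Scheme.{u}} (f : X' ⟶ X) : Prop where
  isProper : IsProper f
  isBirational : IsBirational f
  isNonsingular : IsNonsingular X'
  isIso : ∀ U : X.Opens, (∀ x ∈ U, IsRegularLocalRing (X.presheaf.stalk x)) → IsIso (f ∣_ U)

/-- `t` is a regular system of parameters of the local ring `R`
(a minimal system of generators of the maximal ideal when `R` is regular). -/
def IsRegularSystemOfParameters {R : Type*} [CommRing R] [IsLocalRing R] {d : ℕ}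
    (t : Fin d → R) : Prop :=
  ringKrullDim R = d ∧ Ideal.span (Set.range t) = IsLocalRing.maximalIdeal R

/-- The ideal sheaf `𝐈(H)` of a closed set `H` with its reduced structure. -/
abbrev idealOf {X : Scheme.{u}} (H : Closeds X) : X.IdealSheafData :=
  Scheme.IdealSheafData.vanishingIdeal H

/-- On a non-singular scheme, `H₁, …, H_r` are irreducible hypersurfaces with simple normal
crossings: at every point `x`, the hypersurfaces through `x` are cut out by distinct members of
one regular system of parameters (in particular each of them is a non-singular hypersurface
and they are pairwise distinct). -/
structure IsSimpleNormalCrossings {X : Scheme.{u}} {r : ℕ} (H : Fin r → Closeds X) : Prop where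
  isIrreducible : ∀ i, IsIrreducible (H i : Set X)
  exists_parameters : ∀ x : X, ∃ (d : ℕ) (t : Fin d → X.presheaf.stalk x)
    (σ : {i : Fin r // x ∈ H i} → Fin d),
    IsRegularSystemOfParameters t ∧ Function.Injective σ ∧
      ∀ i, stalkIdeal (idealOf (H i.1)) x = Ideal.span {t (σ i)}

/-- The morphism `f : W' ⟶ W` is a log-resolution of the sheaf of ideals `I` of the non-singular
scheme `W`, with hypersurfaces `H₁, …, H_r` and exponents `a₁, …, a_r`. -/
structure IsLogResolution {W' W : Scheme.{u}} (f : W' ⟶ W) (I : W.IdealSheafData) {r : ℕ}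
    (H : Fin r → Closeds W') (a : Fin r → ℕ) : Prop where
  nonsingular_target : IsNonsingular W
  isProper : IsProper f
  isBirational : IsBirational f
  isNonsingular : IsNonsingular W'
  /-- `f` is an isomorphism outside the support of `I`. -/
  isIso : IsIso (f ∣_ I.support.compl)
  /-- The complement of the preimage of `W ∖ Supp I` is `H₁ ∪ ⋯ ∪ H_r`. -/
  preimage_support : f ⁻¹' (I.support : Set W) = ⋃ i, (H i : Set W')
  isSimpleNormalCrossings : IsSimpleNormalCrossings H
  /-- The total transform `I 𝒪_{W'}` is the monomial `𝐈(H₁) ^ a₁ ⋯ 𝐈(H_r) ^ a_r`. -/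
  totalTransform : I.comap f = ∏ i, idealOf (H i) ^ a i

/-- The function `λ = min {bᵢ / aᵢ}`, where `bᵢ / aᵢ` stands for the function with this value
on `Hᵢ` and the value `∞` outside `Hᵢ`. -/
def lam {X : Scheme.{u}} {r : ℕ} (H : Fin r → Closeds X) (a b : Fin r → ℕ) (x : X) : ℝ≥0∞ :=
  ⨅ (i : Fin r) (_ : x ∈ H i), (b i : ℝ≥0∞) / (a i : ℝ≥0∞)

end ReducedOrder

end

/-! Write `π` for `g ≫ f`. The equality splits into two inequalities, both tested on valuations.

Upper bound (`muSheaf_le_div`): suppose `x'` lies on `H i`. At the generic point of `H i` the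
maximal ideal of the local ring is generated by one non-nilpotent `t`. There `I` and `J` extend to
`(t ^ a i)` and `(t ^ b i)`, because `J'` is trivial at that point. Integral dependence survives
extension of ideals, so comparing powers of `t` bounds `μ` by `b i / a i`.

Lower bound (`div_le_muSheaf`): by `memIntegralClosure_of_valuationSubring`, integrality of `f ^ q`
over `I ^ p` at `x` may be tested in the valuation rings `V` of the function field dominating the
local ring at `x`. As `π` is proper, the map to `V` factors through the local ring of some `x'` over
`x`. There `J ^ q ⊆ I ^ p` follows by comparing monomial exponents. Only the `H i` meeting the fibre
matter, and the least `b i / a i` among them can be taken as `p / q`, so the minimum is attained.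

Semicontinuity: proper sublevel sets are finite unions of the closed sets `π (H i)`. -/

namespace ReducedOrder

/-! ### Integral dependence on ideals in local rings. -/

section Algebra

open Polynomial IsLocalRing

theorem MemIntegralClosure.map {R S : Type*} [CommRing R] [CommRing S] (φ : R →+* S)
    {I : Ideal R} {f : R} (h : MemIntegralClosure I f) :
    MemIntegralClosure (I.map φ) (φ f) := by
  obtain ⟨n, hn, c, hc, e⟩ := h
  refine ⟨n, hn, fun i ↦ φ (c i), fun i hi ↦ ?_, ?_⟩
  · rw [← Ideal.map_pow]
    exact Ideal.mem_map_of_mem φ (hc i hi)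
  · simpa using congr(φ $e)

/-- In a local ring, if `t` is neither a unit nor nilpotent and `t ^ N * u`, with `u` a unit,
is integral over `(t ^ M)`, then `M ≤ N`. -/
theorem MemIntegralClosure.le_of_span_pow {S : Type*} [CommRing S] [IsLocalRing S] {t u : S}
    (ht : t ∈ maximalIdeal S) (ht' : ¬ IsNilpotent t) (hu : IsUnit u) {M N : ℕ}
    (h : MemIntegralClosure (Ideal.span {t ^ M}) (t ^ N * u)) : M ≤ N := by
  by_contra! hlt
  obtain ⟨n, hn, c, hc, e⟩ := h
  -- Since `N + 1 ≤ M`, the `i`-th term is divisible by `t` to the power `(N + 1) * i + N * (n - i)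
  -- = N * n + i`, and `i ≥ 1`.
  have hdvd : t ^ (N * n + 1) ∣ ∑ i ∈ Finset.Icc 1 n, c i * (t ^ N * u) ^ (n - i) := by
    refine Finset.dvd_sum fun i hi ↦ ?_
    obtain ⟨h1, h2⟩ := Finset.mem_Icc.mp hi
    have h3 := hc i hi
    rw [Ideal.span_singleton_pow, Ideal.mem_span_singleton] at h3
    rw [← pow_mul] at h3
    have h4 : t ^ ((N + 1) * i) ∣ c i := (pow_dvd_pow _ (Nat.mul_le_mul_right _ hlt)).trans h3
    have h5 : t ^ (N * (n - i)) ∣ (t ^ N * u) ^ (n - i) := by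
      rw [mul_pow, ← pow_mul]; exact dvd_mul_right _ _
    refine (pow_dvd_pow t ?_).trans ((pow_add t _ _).dvd.trans (mul_dvd_mul h4 h5))
    obtain ⟨k, rfl⟩ := Nat.exists_eq_add_of_le h2
    simp only [add_tsub_cancel_left]
    nlinarith
  obtain ⟨s, hs⟩ := hdvd
  rw [hs, mul_pow, ← pow_mul, pow_succ, mul_assoc, ← mul_add] at e
  have hw : IsUnit (u ^ n + t * s) := by
    by_contra hw
    have := (maximalIdeal S).sub_mem ((mem_maximalIdeal _).mpr hw)
      ((maximalIdeal S).mul_mem_right s ht)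
    rw [add_sub_cancel_right] at this
    exact (mem_maximalIdeal _).mp this (hu.pow n)
  exact ht' ⟨_, hw.mul_left_eq_zero.mp e⟩

/-- The infimum is tested on one `f ∈ J` whose image is exactly `t ^ b` times a unit. Such an `f`
exists, since otherwise `t ^ b ∈ (t ^ (b + 1))` and `t` would be nilpotent. -/
theorem muIdeal_le_div {R S : Type*} [CommRing R] [CommRing S] [IsLocalRing S] (φ : R →+* S)
    {I J : Ideal R} {t : S} (hm : maximalIdeal S = Ideal.span {t}) (ht' : ¬ IsNilpotent t)
    {a b : ℕ} (ha : 0 < a) (hI : I.map φ = Ideal.span {t ^ a})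
    (hJ : J.map φ = Ideal.span {t ^ b}) :
    muIdeal I J ≤ (b : ℝ≥0∞) / a := by
  have ht : t ∈ maximalIdeal S := hm ▸ Ideal.mem_span_singleton_self t
  obtain ⟨f, hf, hf'⟩ : ∃ f ∈ J, φ f ∉ Ideal.span {t ^ (b + 1)} := by
    by_contra! h
    have h1 : J.map φ ≤ Ideal.span {t ^ (b + 1)} := Ideal.map_le_iff_le_comap.mpr h
    rw [hJ, Ideal.span_singleton_le_span_singleton] at h1
    obtain ⟨s, hs⟩ := h1
    have h2 : t ^ b * (1 - t * s) = 0 := by rw [mul_sub, mul_one, ← mul_assoc, ← pow_succ, ← hs,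
      sub_self]
    have h3 : IsUnit (1 - t * s) := by
      by_contra hw
      refine (Ideal.ne_top_iff_one _).mp (maximalIdeal.isMaximal S).ne_top ?_
      simpa using (maximalIdeal S).add_mem ((mem_maximalIdeal _).mpr hw)
        ((maximalIdeal S).mul_mem_right s ht)
    exact ht' ⟨_, h3.mul_left_eq_zero.mp h2⟩
  obtain ⟨u, hu⟩ : t ^ b ∣ φ f := by
    rw [← Ideal.mem_span_singleton, ← hJ]
    exact Ideal.mem_map_of_mem φ hf
  have huu : IsUnit u := by
    by_contra hw
    have : u ∈ maximalIdeal S := (mem_maximalIdeal _).mpr hw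
    rw [hm, Ideal.mem_span_singleton] at this
    rw [hu, Ideal.mem_span_singleton, pow_succ] at hf'
    exact hf' (mul_dvd_mul_left _ this)
  refine (iInf₂_le f hf).trans (sSup_le ?_)
  rintro _ ⟨p, q, hq, h, rfl⟩
  have h1 := h.map φ
  rw [Ideal.map_pow, hI, Ideal.span_singleton_pow, ← pow_mul, map_pow, hu, mul_pow,
    ← pow_mul] at h1
  have h2 := h1.le_of_span_pow ht ht' (huu.pow q)
  rw [ENNReal.le_div_iff_mul_le (by simp [ha.ne']) (by simp), mul_comm, ← mul_div_assoc,
    ENNReal.div_le_iff_le_mul (by simp [hq.ne']) (by simp)]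
  exact_mod_cast h2

/-- Valuative criterion for integral dependence on an ideal of a local domain: it suffices to
consider the valuation rings of the fraction field dominating the ring. -/
theorem memIntegralClosure_of_valuationSubring {R K : Type*} [CommRing R] [IsLocalRing R]
    [IsDomain R] [Field K] [Algebra R K] [IsFractionRing R K] (I : Ideal R) (f : R)
    (h : ∀ (V : ValuationSubring K) (φ : R →+* V), IsLocalHom φ →
      (∀ r, (φ r : K) = algebraMap R K r) → φ f ∈ I.map φ) :
    MemIntegralClosure I f := by
  by_cases hf : f = 0
  · exact ⟨1, one_pos, 0, fun i _ ↦ zero_mem _, by simp [hf]⟩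
  have hf' : algebraMap R K f ≠ 0 := by simpa using hf
  -- Substituting `1 / f` for the variable of the Rees algebra gives the image `R[I / f]` in `K`.
  let ψ : reesAlgebra I →+* K :=
    (aeval (R := R) (algebraMap R K f)⁻¹).toRingHom.comp (reesAlgebra I).val.toRingHom
  have hψ (x : reesAlgebra I) : ψ x = aeval (algebraMap R K f)⁻¹ (x : R[X]) := rfl
  -- `P` contains both the maximal ideal of `R` and the degree-one part `I T`, so a valuation ring
  -- centred on its image dominates `R` and makes `I / f` non-units.
  let P : Ideal (reesAlgebra I) := (maximalIdeal R).comap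
    (constantCoeff.comp (reesAlgebra I).val.toRingHom)
  have hP (x : reesAlgebra I) : x ∈ P ↔ (x : R[X]).coeff 0 ∈ maximalIdeal R := Iff.rfl
  -- If `P` generates the unit ideal, then `1 = ∑ cᵢ / f ^ i` with `cᵢ ∈ I ^ i` and `c₀` in the
  -- maximal ideal. Clearing denominators and dividing by the unit `1 - c₀` gives the integral
  -- equation.
  by_cases htop : P.map ψ.rangeRestrict = ⊤
  · have h1 : (1 : ψ.range) ∈ P.map ψ.rangeRestrict := htop ▸ trivial
    rw [Ideal.mem_map_iff_of_surjective _ ψ.rangeRestrict_surjective] at h1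
    obtain ⟨⟨p, hp⟩, hpP, hp1⟩ := h1
    have hp2 : aeval (algebraMap R K f)⁻¹ p = 1 := congr(($hp1 : K))
    rw [hP] at hpP
    obtain ⟨u, hu⟩ : IsUnit (1 - p.coeff 0) := by
      by_contra hw
      refine (Ideal.ne_top_iff_one _).mp (maximalIdeal.isMaximal R).ne_top ?_
      simpa using (maximalIdeal R).add_mem ((mem_maximalIdeal _).mpr hw) hpP
    -- The extra `1` keeps the degree of the equation positive when `p` is constant.
    refine ⟨p.natDegree + 1, by simp, fun i ↦ -(↑u⁻¹ * p.coeff i), fun i _ ↦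
      (I ^ i).neg_mem ((I ^ i).mul_mem_left _ (hp i)), ?_⟩
    rw [aeval_eq_sum_range' (n := p.natDegree + 1 + 1) (by omega), Finset.sum_range_eq_add_Ico _
      (by omega)] at hp2
    have key : f ^ (p.natDegree + 1) = p.coeff 0 * f ^ (p.natDegree + 1) +
        ∑ i ∈ Finset.Icc 1 (p.natDegree + 1), p.coeff i * f ^ (p.natDegree + 1 - i) := by
      apply IsFractionRing.injective R K
      have := congr($hp2 * algebraMap R K f ^ (p.natDegree + 1))
      rw [one_mul, add_mul, Finset.sum_mul] at this
      simp only [map_add, map_mul, map_sum, map_pow]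
      refine this.symm.trans ?_
      congr 1
      · simp [Algebra.smul_def]
      · refine Finset.sum_congr (by ext; simp) fun i hi ↦ ?_
        have : i ≤ p.natDegree + 1 := by simp at hi; omega
        rw [Algebra.smul_def, mul_assoc, pow_sub₀ _ hf' this, inv_pow, mul_comm (_ ^ i)⁻¹]
    have key' : f ^ (p.natDegree + 1) = ↑u⁻¹ *
        ∑ i ∈ Finset.Icc 1 (p.natDegree + 1), p.coeff i * f ^ (p.natDegree + 1 - i) := by
      rw [← sub_eq_iff_eq_add'.mpr key, ← one_sub_mul, ← hu, Units.inv_mul_cancel_left]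
    rw [key', Finset.mul_sum, ← Finset.sum_add_distrib]
    simp [mul_assoc]
  -- Otherwise some `V` dominates `R` with `I V ⊆ f 𝔪_V`, which contradicts `f ∈ I V`.
  · exfalso
    obtain ⟨V, hV, hV'⟩ := Ideal.image_subset_nonunits_valuationSubring _ htop
    have hC (r : R) : algebraMap R K r = ψ (algebraMap R _ r) := by
      rw [hψ]; simp
    let φ : R →+* V := (algebraMap R K).codRestrict V.toSubring fun r ↦
      hV ⟨algebraMap R _ r, (hC r).symm⟩
    have hφ (r : R) : (φ r : K) = algebraMap R K r := rfl
    have hPV (x : reesAlgebra I) (hx : x ∈ P) : ψ x ∈ V.nonunits :=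
      hV' ⟨ψ.rangeRestrict x, Ideal.mem_map_of_mem _ hx, rfl⟩
    have hloc : IsLocalHom φ := by
      refine ⟨fun r hr ↦ ?_⟩
      by_contra hr'
      have h1 := hPV (algebraMap R _ r) (by
        rw [hP]
        simpa [Subalgebra.coe_algebraMap] using hr')
      rw [← hC, ← hφ, ValuationSubring.coe_mem_nonunits_iff] at h1
      exact (mem_maximalIdeal _).mp h1 hr
    have hle : I.map φ ≤ Ideal.span {φ f} * maximalIdeal V := by
      refine Ideal.map_le_iff_le_comap.mpr fun g hg ↦ ?_
      let x : reesAlgebra I := ⟨monomial 1 g, reesAlgebra.monomial_mem.mpr (by simpa using hg)⟩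
      have hx : ψ x = algebraMap R K g * (algebraMap R K f)⁻¹ := by
        rw [hψ]; simp [x, aeval_monomial]
      have h1 := hPV x (by rw [hP]; simp [x, coeff_monomial])
      obtain ⟨h2, h3⟩ := ValuationSubring.mem_nonunits_iff_exists_mem_maximalIdeal.mp h1
      refine Ideal.mem_span_singleton_mul.mpr ⟨_, h3, Subtype.ext ?_⟩
      simp only [MulMemClass.coe_mul, hφ, hx]
      field_simp
    obtain ⟨w, hw, e⟩ := Ideal.mem_span_singleton_mul.mp (hle (h V φ hloc hφ))
    have hφf : φ f ≠ 0 := fun h0 ↦ hf' (by rw [← hφ, h0]; rfl)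
    have : w = 1 := by simpa [hφf] using e
    exact (Ideal.ne_top_iff_one _).mp (maximalIdeal.isMaximal V).ne_top (this ▸ hw)

end Algebra

/-! ### Stalks of ideal sheaves and their inverse images. -/

section StalkIdeal

variable {X Y Z : Scheme.{u}}

/-- Two affine neighbourhoods of `x` contribute the same ideal, because both agree with a smaller
affine one in their intersection. -/
theorem stalkIdeal_eq_map_germ (I : X.IdealSheafData) {x : X} (U : X.affineOpens) (hx : x ∈ U.1) :
    stalkIdeal I x = (I.ideal U).map (X.presheaf.germ U.1 x hx).hom := by
  refine le_antisymm (iSup₂_le fun V hV ↦ ?_) (le_iSup₂_of_le U hx le_rfl)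
  obtain ⟨_, ⟨W, hW, rfl⟩, hxW, hWUV⟩ := X.isBasis_affineOpens.exists_subset_of_mem_open
    (show x ∈ (U.1 ⊓ V.1 : X.Opens) from ⟨hx, hV⟩) (U.1 ⊓ V.1).2
  have key (T : X.affineOpens) (hT : x ∈ T.1) (h : W ≤ T.1) :
      (I.ideal T).map (X.presheaf.germ T.1 x hT).hom =
        (I.ideal ⟨W, hW⟩).map (X.presheaf.germ W x hxW).hom := by
    rw [← I.map_ideal (U := ⟨W, hW⟩) (V := T) h, Ideal.map_map, ← CommRingCat.hom_comp]
    congr 2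
    exact (X.presheaf.germ_res (homOfLE h) x hxW).symm
  exact ((key V hV (hWUV.trans inf_le_right)).trans (key U hx (hWUV.trans inf_le_left)).symm).le

theorem exists_affineOpens_mem (x : X) : ∃ U : X.affineOpens, x ∈ U.1 := by
  obtain ⟨_, ⟨U, hU, rfl⟩, hx, -⟩ := X.isBasis_affineOpens.exists_subset_of_mem_open
    (Set.mem_univ x) isOpen_univ
  exact ⟨⟨U, hU⟩, hx⟩

theorem stalkIdeal_mul (I J : X.IdealSheafData) (x : X) :
    stalkIdeal (I * J) x = stalkIdeal I x * stalkIdeal J x := by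
  obtain ⟨U, hU⟩ := exists_affineOpens_mem x
  simp [stalkIdeal_eq_map_germ _ U hU, Ideal.map_mul]

theorem stalkIdeal_top (x : X) : stalkIdeal (⊤ : X.IdealSheafData) x = ⊤ := by
  obtain ⟨U, hU⟩ := exists_affineOpens_mem x
  simp [stalkIdeal_eq_map_germ _ U hU, Ideal.map_top]

theorem stalkIdeal_pow (I : X.IdealSheafData) (n : ℕ) (x : X) :
    stalkIdeal (I ^ n) x = stalkIdeal I x ^ n := by
  obtain ⟨U, hU⟩ := exists_affineOpens_mem x
  simp [stalkIdeal_eq_map_germ _ U hU, Ideal.map_pow]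

theorem stalkIdeal_prod {ι : Type*} (s : Finset ι) (I : ι → X.IdealSheafData) (x : X) :
    stalkIdeal (∏ i ∈ s, I i) x = ∏ i ∈ s, stalkIdeal (I i) x := by
  classical
  induction s using Finset.induction_on with
  | empty => simpa using stalkIdeal_top x
  | insert i s hi ih => rw [Finset.prod_insert hi, Finset.prod_insert hi, stalkIdeal_mul, ih]

theorem stalkIdeal_le_maximalIdeal_iff (I : X.IdealSheafData) (x : X) :
    stalkIdeal I x ≤ IsLocalRing.maximalIdeal (X.presheaf.stalk x) ↔ x ∈ I.support := by
  obtain ⟨U, hU⟩ := exists_affineOpens_mem x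
  rw [stalkIdeal_eq_map_germ _ U hU, Scheme.IdealSheafData.mem_support_iff_of_mem hU,
    Ideal.map_le_iff_le_comap, Scheme.mem_zeroLocus_iff]
  refine forall₂_congr fun f _ ↦ ?_
  rw [Scheme.mem_basicOpen _ _ _ hU, Ideal.mem_comap, IsLocalRing.mem_maximalIdeal]
  rfl

theorem stalkIdeal_eq_top_iff (I : X.IdealSheafData) (x : X) :
    stalkIdeal I x = ⊤ ↔ x ∉ I.support := by
  rw [← stalkIdeal_le_maximalIdeal_iff]
  exact ⟨fun h h' ↦ (IsLocalRing.maximalIdeal.isMaximal _).ne_top (top_le_iff.mp (h ▸ h')),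
    fun h ↦ by_contra fun h' ↦ h (IsLocalRing.le_maximalIdeal h')⟩

theorem support_idealOf (H : Closeds X) : (idealOf H).support = H :=
  SetLike.coe_injective (Scheme.IdealSheafData.coe_support_vanishingIdeal H)

theorem stalkIdeal_specializes (I : X.IdealSheafData) {x y : X} (h : x ⤳ y) :
    (stalkIdeal I y).map (X.presheaf.stalkSpecializes h).hom = stalkIdeal I x := by
  obtain ⟨U, hU⟩ := exists_affineOpens_mem y
  rw [stalkIdeal_eq_map_germ _ U hU, stalkIdeal_eq_map_germ _ U (h.mem_open U.1.2 hU),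
    Ideal.map_map, ← CommRingCat.hom_comp, X.presheaf.germ_stalkSpecializes]

/-- The stalk at a generic point `x` of a closed set with its reduced structure. -/
theorem stalkIdeal_idealOf_of_closure_singleton {H : Closeds X} {x : X}
    (hx : closure {x} = (H : Set X)) :
    stalkIdeal (idealOf H) x = IsLocalRing.maximalIdeal (X.presheaf.stalk x) := by
  refine le_antisymm ?_ ?_
  · rw [stalkIdeal_le_maximalIdeal_iff, support_idealOf, ← SetLike.mem_coe, ← hx]
    exact subset_closure rfl
  · obtain ⟨U, hU⟩ := exists_affineOpens_mem x
    rw [stalkIdeal_eq_map_germ _ U hU]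
    let : Algebra Γ(X, U.1) (X.presheaf.stalk x) := (X.presheaf.germ U.1 x hU).hom.toAlgebra
    have := U.2.isLocalization_stalk ⟨x, hU⟩
    refine (IsLocalization.AtPrime.map_eq_maximalIdeal (U.2.primeIdealOf ⟨x, hU⟩).asIdeal
      (X.presheaf.stalk x)).ge.trans (Ideal.map_mono ?_)
    -- Every point of `H` in `U` is a specialization of `x`, so its prime contains the prime of `x`;
    -- hence sections in that prime vanish on all of `H ∩ U`.
    rw [Scheme.IdealSheafData.vanishingIdeal_ideal]
    intro s hs
    rw [PrimeSpectrum.mem_vanishingIdeal]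
    intro q hq
    have hU' : IsAffineOpen U.1 := U.2
    have h1 : x ⤳ hU'.fromSpec q := specializes_iff_mem_closure.mpr (hx ▸ hq)
    have h2 : hU'.fromSpec (hU'.primeIdealOf ⟨x, hU⟩) = x := hU'.fromSpec_primeIdealOf ⟨x, hU⟩
    rw [← h2] at h1
    exact (PrimeSpectrum.le_iff_specializes _ _).mpr
      (hU'.fromSpec.isOpenEmbedding.isInducing.specializes_iff.mp h1) hs

/-- The stalk at `x` of the inverse image ideal sheaf along `f` is the extension of the stalk
at `f x`. This holds for all morphisms, see `stalkIdeal_comap`. -/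
def PreservesStalkIdeal (f : X ⟶ Y) (x : X) : Prop :=
  ∀ I : Y.IdealSheafData,
    stalkIdeal (I.comap f) x = (stalkIdeal I (f x)).map (f.stalkMap x).hom

theorem PreservesStalkIdeal.comp {f : X ⟶ Y} {g : Y ⟶ Z} {x : X}
    (hf : PreservesStalkIdeal f x) (hg : PreservesStalkIdeal g (f x)) :
    PreservesStalkIdeal (f ≫ g) x := by
  intro I
  rw [Scheme.IdealSheafData.comap_comp, hf, hg, Ideal.map_map, ← CommRingCat.hom_comp,
    Scheme.Hom.stalkMap_comp]
  rfl

theorem PreservesStalkIdeal.of_comp {f : X ⟶ Y} {g : Y ⟶ Z} {x : X}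
    [IsOpenImmersion f] (hf : PreservesStalkIdeal f x) (h : PreservesStalkIdeal (f ≫ g) x) :
    PreservesStalkIdeal g (f x) := by
  intro I
  have h1 := h I
  rw [Scheme.IdealSheafData.comap_comp, hf, Scheme.Hom.stalkMap_comp] at h1
  have h2 := h1.trans (Ideal.map_map (I := stalkIdeal I (g (f x))) (g.stalkMap (f x)).hom
    (f.stalkMap x).hom).symm
  have hb : Function.Bijective (f.stalkMap x).hom := ConcreteCategory.bijective_of_isIso _
  rw [← Ideal.comap_map_of_bijective _ hb (I := stalkIdeal (I.comap g) (f x)), h2,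
    Ideal.comap_map_of_bijective _ hb]

theorem preservesStalkIdeal_of_isOpenImmersion (f : X ⟶ Y) [IsOpenImmersion f] (x : X) :
    PreservesStalkIdeal f x := by
  intro I
  obtain ⟨U, hU⟩ := exists_affineOpens_mem x
  have hU' : f x ∈ f ''ᵁ U.1 := ⟨x, hU, rfl⟩
  rw [stalkIdeal_eq_map_germ _ U hU, stalkIdeal_eq_map_germ I
    ⟨f ''ᵁ U, U.2.image_of_isOpenImmersion f⟩ hU', Ideal.map_map,
    Scheme.IdealSheafData.ideal_comap_of_isOpenImmersion]
  have : (I.ideal ⟨f ''ᵁ U, U.2.image_of_isOpenImmersion f⟩).comap (f.appIso U).inv.hom =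
    (I.ideal ⟨f ''ᵁ U, U.2.image_of_isOpenImmersion f⟩).map (f.appIso U).hom.hom :=
    (Ideal.map_comap_of_equiv (f.appIso U).commRingCatIsoToRingEquiv).symm
  rw [this, Ideal.map_map, ← CommRingCat.hom_comp, ← CommRingCat.hom_comp]
  congr 2
  refine Eq.trans ?_ (f.germ_stalkMap (f ''ᵁ U.1) x hU').symm
  rw [Scheme.Hom.appIso_hom, Category.assoc]
  congr 1
  exact X.presheaf.germ_res _ _ _

/-- Inverse image is left adjoint to `map`, and `map` contracts ideals of global sections. Extension
of ideals is left adjoint to contraction, so the two agree. -/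
theorem ideal_comap_of_isAffine [IsAffine X] [IsAffine Y] (f : X ⟶ Y) (I : Y.IdealSheafData) :
    (I.comap f).ideal ⟨⊤, isAffineOpen_top X⟩ =
      (I.ideal ⟨⊤, isAffineOpen_top Y⟩).map f.appTop.hom := by
  have key (J : X.IdealSheafData) : I.comap f ≤ J ↔
      (I.ideal ⟨⊤, isAffineOpen_top Y⟩).map f.appTop.hom ≤ J.ideal ⟨⊤, isAffineOpen_top X⟩ := by
    rw [← Scheme.IdealSheafData.le_map_iff_comap_le, Ideal.map_le_iff_le_comap]
    have := Scheme.IdealSheafData.ideal_map J f ⟨⊤, isAffineOpen_top Y⟩ (isAffineOpen_top X)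
    refine Iff.trans ?_ (Iff.of_eq congr(_ ≤ $this))
    exact ⟨fun h ↦ h _, Scheme.IdealSheafData.le_of_isAffine⟩
  refine le_antisymm ?_ ((key _).mp le_rfl)
  obtain ⟨J, hJ⟩ := (Scheme.IdealSheafData.equivOfIsAffine (X := X)).surjective
    ((I.ideal ⟨⊤, isAffineOpen_top Y⟩).map f.appTop.hom)
  exact ((key J).mpr hJ.ge _).trans hJ.le

theorem preservesStalkIdeal_of_isAffine [IsAffine X] [IsAffine Y] (f : X ⟶ Y) (x : X) :
    PreservesStalkIdeal f x := by
  intro I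
  rw [stalkIdeal_eq_map_germ _ ⟨⊤, isAffineOpen_top X⟩ trivial,
    stalkIdeal_eq_map_germ _ ⟨⊤, isAffineOpen_top Y⟩ trivial, ideal_comap_of_isAffine,
    Ideal.map_map, Ideal.map_map, ← CommRingCat.hom_comp, ← CommRingCat.hom_comp]
  congr 2
  exact (f.germ_stalkMap ⊤ x trivial).symm

/-- Restricting to an affine neighbourhood mapping into an affine open reduces this to affine
schemes; the open immersion is then cancelled, being an isomorphism on stalks. -/
theorem stalkIdeal_comap (f : X ⟶ Y) (I : Y.IdealSheafData) (x : X) :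
    stalkIdeal (I.comap f) x = (stalkIdeal I (f x)).map (f.stalkMap x).hom := by
  obtain ⟨V, hV⟩ := exists_affineOpens_mem (f x)
  obtain ⟨_, ⟨(U : X.Opens), hU, rfl⟩, hxU, hUV⟩ :=
    X.isBasis_affineOpens.exists_subset_of_mem_open (show x ∈ f ⁻¹ᵁ V.1 from hV) (f ⁻¹ᵁ V.1).2
  have : IsAffine U := hU
  have : IsAffine V.1 := V.2
  have h1 : PreservesStalkIdeal (U.ι ≫ f) ⟨x, hxU⟩ := by
    rw [← Scheme.Hom.resLE_comp_ι f hUV]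
    exact (preservesStalkIdeal_of_isAffine _ _).comp (preservesStalkIdeal_of_isOpenImmersion _ _)
  exact (preservesStalkIdeal_of_isOpenImmersion U.ι ⟨x, hxU⟩).of_comp h1 I

end StalkIdeal

/-! ### Lifting the generic point and valuation rings along proper birational morphisms. -/

section Birational

variable {X X' T : Scheme.{u}} {f : X' ⟶ X}

theorem IsBirational.dense_range (hf : IsBirational f) : Dense (Set.range f) := by
  obtain ⟨e, he⟩ := hf
  refine e.dense_target.mono fun x hx ↦ ?_
  refine ⟨e.source.ι (e.iso.inv ⟨x, hx⟩), ?_⟩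
  have : e.iso.inv ≫ e.source.ι ≫ f = e.target.ι := by
    rw [← he, Iso.inv_hom_id_assoc, Category.comp_id]
  exact congr($this ⟨x, hx⟩)

theorem IsBirational.surjective (hf : IsBirational f) [IsProper f] : Function.Surjective f := by
  rw [← Set.range_eq_univ, ← f.isClosedMap.isClosed_range.closure_eq]
  exact hf.dense_range.closure_eq

/-- A morphism whose image lies in every nonempty open set (such as the inclusion of the
generic point) lifts along a birational morphism. -/
theorem IsBirational.exists_lift (hf : IsBirational f) [Nonempty T] (h : T ⟶ X)
    (hh : ∀ U : X.Opens, (U : Set X).Nonempty → Set.range h ⊆ U) :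
    ∃ h' : T ⟶ X', h' ≫ f = h ∧
      ∀ U : X'.Opens, (U : Set X').Nonempty → Set.range h' ⊆ U := by
  obtain ⟨e, he⟩ := hf
  have : Nonempty X := ⟨h (Classical.arbitrary T)⟩
  have hU : Set.range h ⊆ Set.range e.target.ι := by
    rw [Scheme.Opens.range_ι]
    exact hh _ e.dense_target.nonempty
  let h₀ := IsOpenImmersion.lift e.target.ι h hU
  have hh₀ : h₀ ≫ e.target.ι = h := IsOpenImmersion.lift_fac _ _ _
  refine ⟨h₀ ≫ e.iso.inv ≫ e.source.ι, ?_, ?_⟩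
  · replace he : e.iso.hom ≫ e.target.ι ≫ 𝟙 X = e.source.ι ≫ f := he
    rw [Category.comp_id] at he
    simp only [Category.assoc, ← he, Iso.inv_hom_id_assoc, hh₀]
  -- `W` meets the dense source of the birational isomorphism and so yields a nonempty open of `X`,
  -- which contains the image of `h`. This conclusion lets the lift be repeated along a second
  -- birational morphism.
  · intro W hW
    obtain ⟨w, hw, hw'⟩ := e.dense_source.inter_open_nonempty _ W.2 hW
    have hne : ((e.target.ι ''ᵁ (e.iso.inv ⁻¹ᵁ (e.source.ι ⁻¹ᵁ W)) : X.Opens) : Set X).Nonempty := by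
      refine ⟨e.target.ι (e.iso.hom ⟨w, hw'⟩), _, ?_, rfl⟩
      have h1 : e.source.ι (e.iso.inv (e.iso.hom ⟨w, hw'⟩)) = w :=
        congr(e.source.ι ($(e.iso.hom_inv_id) ⟨w, hw'⟩))
      have h2 : e.source.ι (e.iso.inv (e.iso.hom ⟨w, hw'⟩)) ∈ W := by rwa [h1]
      exact h2
    rintro _ ⟨t, rfl⟩
    obtain ⟨y, hy, hyt⟩ := hh _ hne ⟨t, rfl⟩
    rw [← hh₀, Scheme.Hom.comp_apply] at hyt
    rw [e.target.ι.isOpenEmbedding.injective hyt] at hy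
    exact hy

/-- A valuation ring of the function field dominating the local ring of a point dominates
the local ring of a point of a proper birational modification over that point. -/
theorem exists_stalk_hom_of_valuationSubring [AlgebraicGeometry.IsIntegral X] [IsProper f]
    (h : Spec X.functionField ⟶ X') (hh : h ≫ f = X.fromSpecStalk (genericPoint X))
    (x : X) (V : ValuationSubring X.functionField)
    (φ : X.presheaf.stalk x →+* V) (hφ : IsLocalHom φ)
    (hφ' : ∀ r, (φ r : X.functionField) = algebraMap (X.presheaf.stalk x) X.functionField r) :
    ∃ (x' : X') (hx' : f x' = x) (ψ : X'.presheaf.stalk x' →+* V), ∀ r,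
      ψ ((f.stalkMap x').hom r) = φ ((X.presheaf.stalkSpecializes (.of_eq hx'.symm)).hom r) := by
  have hcomp : CommRingCat.ofHom φ ≫ CommRingCat.ofHom (algebraMap V X.functionField) =
      X.presheaf.stalkSpecializes ((genericPoint_spec X).specializes trivial) := by
    ext r
    exact hφ' r
  have hE : ValuativeCriterion.Existence f := by
    have : UniversallyClosed f := inferInstance
    rw [UniversallyClosed.eq_valuativeCriterion] at this
    exact this.1
  let i₂ : Spec (.of V) ⟶ X := Spec.map (CommRingCat.ofHom φ) ≫ X.fromSpecStalk x
  let S : ValuativeCommSq f :=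
    { R := V
      K := X.functionField
      i₁ := h
      i₂ := i₂
      commSq := ⟨by
        rw [hh]
        simp only [i₂]
        rw [← Category.assoc, ← Spec.map_comp, hcomp,
          Scheme.SpecMap_stalkSpecializes_fromSpecStalk]⟩ }
  obtain ⟨⟨l, -, hl⟩⟩ := (hE S).exists_lift
  change l ≫ f = i₂ at hl
  -- A morphism from the spectrum of a local ring is a point together with a local homomorphism from
  -- its stalk; hence `l` sends the closed point of `V` to a point over `x`.
  have h1 : SpecToEquivOfLocalRing X (.of V) (l ≫ f) = ⟨x, CommRingCat.ofHom φ, hφ⟩ := by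
    rw [hl]
    exact (SpecToEquivOfLocalRing X (.of V)).apply_symm_apply ⟨x, CommRingCat.ofHom φ, hφ⟩
  obtain ⟨hx', h2⟩ := SpecToEquivOfLocalRing_eq_iff.mp h1
  refine ⟨l (IsLocalRing.closedPoint V), hx', (Scheme.stalkClosedPointTo l).hom, fun r ↦ ?_⟩
  exact congr($((Scheme.stalkClosedPointTo_comp l f).symm.trans h2).hom r)

end Birational

/-! ### Local rings with principal maximal ideal. -/

section Dimension

open IsLocalRing

/-- A nilpotent `t` would lie in every prime, leaving the maximal ideal as the only one. -/
theorem not_isNilpotent_of_maximalIdeal_eq_span {R : Type*} [CommRing R] [IsLocalRing R] {t : R}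
    (ht : maximalIdeal R = Ideal.span {t}) (hR : 0 < ringKrullDim R) : ¬ IsNilpotent t := by
  intro hn
  refine hR.not_ge ?_
  have : Subsingleton (PrimeSpectrum R) := by
    refine ⟨fun p q ↦ ?_⟩
    have key (p : PrimeSpectrum R) : p.asIdeal = maximalIdeal R := by
      refine le_antisymm (le_maximalIdeal p.2.ne_top) ?_
      rw [ht, Ideal.span_singleton_le_iff_mem]
      exact nilradical_le_prime p.asIdeal hn
    exact PrimeSpectrum.ext ((key p).trans (key q).symm)
  exact Order.krullDim_nonpos_of_subsingleton

/-- This is Krull's principal ideal theorem. -/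
theorem ringKrullDim_le_one_of_maximalIdeal_eq_span {R : Type*} [CommRing R] [IsLocalRing R]
    [IsNoetherianRing R] {t : R} (ht : maximalIdeal R = Ideal.span {t}) : ringKrullDim R ≤ 1 := by
  rw [← maximalIdeal_height_eq_ringKrullDim]
  have : (maximalIdeal R).IsPrincipal := ⟨t, ht⟩
  have := Ideal.height_le_one_of_isPrincipal_of_mem_minimalPrimes (maximalIdeal R) (maximalIdeal R)
    (by rw [Ideal.minimalPrimes_eq_subsingleton_self]; rfl)
  exact_mod_cast this

end Dimension

/-! ### The two inequalities and semicontinuity. -/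

section Main

variable {X X' : Scheme.{u}} {r : ℕ} {H : Fin r → Closeds X'} {a b : Fin r → ℕ}

/-- The maximal ideal at `η` is the stalk of the ideal of `H i`, hence principal, so the dimension
is one. A system of parameters then has a single member, and injectivity of `σ` excludes every other
`H j` from passing through `η`. -/
theorem IsSimpleNormalCrossings.stalkIdeal_prod_pow_of_closure_singleton
    (hX' : IsNonsingular X') (hH : IsSimpleNormalCrossings H) {i : Fin r} {η : X'}
    (hη : closure {η} = (H i : Set X')) :
    ∃ t : X'.presheaf.stalk η, IsLocalRing.maximalIdeal (X'.presheaf.stalk η) = Ideal.span {t} ∧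
      ¬ IsNilpotent t ∧ ∀ c : Fin r → ℕ,
        stalkIdeal (∏ j, idealOf (H j) ^ c j) η = Ideal.span {t ^ c i} := by
  have hηi : η ∈ H i := by
    rw [← SetLike.mem_coe, ← hη]
    exact subset_closure rfl
  obtain ⟨d, t, σ, ht, hσ, h⟩ := hH.exists_parameters η
  have := hX' η
  have hm := (h ⟨i, hηi⟩).symm.trans (stalkIdeal_idealOf_of_closure_singleton hη)
  have hd : d ≤ 1 := by
    have := ringKrullDim_le_one_of_maximalIdeal_eq_span hm.symm
    rw [ht.1] at this
    exact_mod_cast this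
  refine ⟨t (σ ⟨i, hηi⟩), hm.symm, not_isNilpotent_of_maximalIdeal_eq_span hm.symm ?_, fun c ↦ ?_⟩
  · rw [ht.1]
    exact_mod_cast (σ ⟨i, hηi⟩).pos
  · rw [stalkIdeal_prod, Finset.prod_eq_single i, stalkIdeal_pow, h ⟨i, hηi⟩,
      Ideal.span_singleton_pow]
    · intro j _ hj
      rw [stalkIdeal_pow, (stalkIdeal_eq_top_iff _ _).mpr, Ideal.top_pow, Ideal.one_eq_top]
      intro hηj
      rw [support_idealOf] at hηj
      have h1 : σ ⟨i, hηi⟩ = σ ⟨j, hηj⟩ := by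
        ext
        have := (σ ⟨i, hηi⟩).2
        have := (σ ⟨j, hηj⟩).2
        omega
      exact hj congr(($(hσ h1)).1).symm
    · simp

theorem muSheaf_le_div (π : X' ⟶ X) (hX' : IsNonsingular X') (hH : IsSimpleNormalCrossings H)
    (I J : X.IdealSheafData) (J' : X'.IdealSheafData)
    (hI : I.comap π = ∏ i, idealOf (H i) ^ a i)
    (hJ : J.comap π = (∏ i, idealOf (H i) ^ b i) * J')
    {i : Fin r} (ha : 0 < a i) (hJ' : ¬ J' ≤ idealOf (H i)) {x' : X'} (hx' : x' ∈ H i) :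
    muSheaf I J (π x') ≤ (b i : ℝ≥0∞) / a i := by
  obtain ⟨η, hη⟩ := QuasiSober.sober (hH.isIrreducible i) (H i).isClosed
  have hη' : closure {η} = (H i : Set X') := hη
  have hs : η ⤳ x' := specializes_iff_mem_closure.mpr (hη' ▸ hx')
  obtain ⟨t, hm, ht, hprod⟩ := hH.stalkIdeal_prod_pow_of_closure_singleton hX' hη'
  have key (K : X.IdealSheafData) : (stalkIdeal K (π x')).map
      ((X'.presheaf.stalkSpecializes hs).hom.comp (π.stalkMap x').hom) =
      stalkIdeal (K.comap π) η := by
    rw [← Ideal.map_map, ← stalkIdeal_comap, stalkIdeal_specializes]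
  refine muIdeal_le_div _ hm ht ha ((key I).trans ?_) ((key J).trans ?_)
  · rw [hI, hprod]
  · rw [hJ, stalkIdeal_mul, hprod, (stalkIdeal_eq_top_iff J' η).mpr, Ideal.mul_top]
    intro h
    -- If `η` were in the support of `J'`, so would be its closure `H i`.
    refine hJ' (Scheme.IdealSheafData.le_support_iff_le_vanishingIdeal.mp ?_)
    rw [← SetLike.coe_subset_coe, ← hη']
    exact closure_minimal (Set.singleton_subset_iff.mpr h) J'.support.isClosed

/-- If `b i / a i ≥ p / q` for all `i` such that `H i` meets the fibre over `x`, then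
`f ^ q` is integral over `I ^ p` at `x` for all `f ∈ J`. -/
theorem div_le_muSheaf [AlgebraicGeometry.IsIntegral X] (π : X' ⟶ X) [IsProper π]
    (h : Spec X.functionField ⟶ X') (hh : h ≫ π = X.fromSpecStalk (genericPoint X))
    (I J : X.IdealSheafData) (J' : X'.IdealSheafData)
    (hI : I.comap π = ∏ i, idealOf (H i) ^ a i)
    (hJ : J.comap π = (∏ i, idealOf (H i) ^ b i) * J') (x : X) {p q : ℕ} (hq : 0 < q)
    (hpq : ∀ i, ∀ x' ∈ H i, π x' = x → a i * p ≤ b i * q) :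
    (p : ℝ≥0∞) / q ≤ muSheaf I J x := by
  refine le_iInf₂ fun f hf ↦ le_sSup ⟨p, q, hq, ?_, rfl⟩
  refine memIntegralClosure_of_valuationSubring (K := X.functionField) _ _ fun V φ hφ hφ' ↦ ?_
  obtain ⟨x', rfl, ψ, hψ⟩ := exists_stalk_hom_of_valuationSubring h hh x V φ hφ hφ'
  have hφψ : φ = ψ.comp (π.stalkMap x').hom := by
    ext r
    simpa using congr(($(hψ r)).1).symm
  have h1 : (stalkIdeal J (π x')).map (π.stalkMap x').hom ^ q ≤
      (stalkIdeal I (π x')).map (π.stalkMap x').hom ^ p := by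
    rw [← stalkIdeal_comap, ← stalkIdeal_comap, hI, hJ, stalkIdeal_mul]
    refine (Ideal.pow_right_mono Ideal.mul_le_left q).trans ?_
    rw [stalkIdeal_prod, stalkIdeal_prod, ← Finset.prod_pow, ← Finset.prod_pow]
    refine Finset.prod_le_prod' fun i _ ↦ ?_
    rw [stalkIdeal_pow, stalkIdeal_pow, ← pow_mul, ← pow_mul]
    by_cases hi : x' ∈ H i
    · exact Ideal.pow_le_pow_right (hpq i x' hi rfl)
    · rw [(stalkIdeal_eq_top_iff _ x').mpr (by rwa [support_idealOf]), Ideal.top_pow, Ideal.top_pow]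
  rw [hφψ, ← Ideal.map_map, Ideal.map_pow]
  refine Ideal.mem_map_of_mem ψ (h1 ?_)
  rw [map_pow]
  exact Ideal.pow_mem_pow (Ideal.mem_map_of_mem _ hf) q

theorem exists_muSheaf_eq_lam [AlgebraicGeometry.IsIntegral X] (π : X' ⟶ X) [IsProper π]
    (hπ : Function.Surjective π)
    (h : Spec X.functionField ⟶ X') (hh : h ≫ π = X.fromSpecStalk (genericPoint X))
    (I J : X.IdealSheafData) (J' : X'.IdealSheafData) (ha : ∀ i, 0 < a i)
    (hI : I.comap π = ∏ i, idealOf (H i) ^ a i)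
    (hJ : J.comap π = (∏ i, idealOf (H i) ^ b i) * J') (x : X) :
    ∃ x', π x' = x ∧ lam H a b x' ≤ muSheaf I J x := by
  classical
  let S : Finset (Fin r) := {i | ∃ x' ∈ H i, π x' = x}
  by_cases hS : S.Nonempty
  · obtain ⟨i, hi, hmin⟩ := S.exists_min_image (fun i ↦ (b i : ℝ≥0∞) / a i) hS
    obtain ⟨x', hx', rfl⟩ := (Finset.mem_filter.mp hi).2
    refine ⟨x', rfl, (iInf₂_le i hx').trans
      -- The minimal quotient itself is used, with `p = b i` and `q = a i`, so no approximation is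
      -- needed.
      (div_le_muSheaf π h hh I J J' hI hJ _ (ha i) fun j y hy hyx ↦ ?_)⟩
    have := hmin j (Finset.mem_filter.mpr ⟨Finset.mem_univ _, y, hy, hyx⟩)
    rw [ENNReal.le_div_iff_mul_le (by simp [(ha j).ne']) (by simp), mul_comm, ← mul_div_assoc,
      ENNReal.div_le_iff_le_mul (by simp [(ha i).ne']) (by simp)] at this
    exact_mod_cast this
  -- No `H i` meets the fibre, so the exponent condition is vacuous and every integer `n / 1` bounds
  -- `μ` from below.
  · obtain ⟨x', rfl⟩ := hπ x
    refine ⟨x', rfl, le_top.trans (top_le_iff.mpr (ENNReal.eq_top_of_forall_nnreal_le ?_))⟩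
    intro c
    obtain ⟨n, hn⟩ := exists_nat_ge c
    have h1 := div_le_muSheaf (p := n) π h hh I J J' hI hJ (π x') one_pos fun i y hy hyx ↦
      (hS ⟨i, Finset.mem_filter.mpr ⟨Finset.mem_univ _, y, hy, hyx⟩⟩).elim
    refine le_trans ?_ h1
    rw [Nat.cast_one, div_one]
    exact_mod_cast hn

theorem lowerSemicontinuous_of_isLeast {F : X → ℝ≥0∞} (π : X' ⟶ X) [IsProper π]
    (hF : ∀ x, IsLeast (lam H a b '' (π ⁻¹' {x})) (F x)) : LowerSemicontinuous F := by
  rw [lowerSemicontinuous_iff_isClosed_preimage]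
  intro y
  obtain rfl | hy := eq_or_ne y ⊤
  · simp
  have : F ⁻¹' Set.Iic y = ⋃ i ∈ {i | (b i : ℝ≥0∞) / a i ≤ y}, π '' (H i : Set X') := by
    ext x
    simp only [Set.mem_preimage, Set.mem_Iic, Set.mem_iUnion, Set.mem_ofPred_eq, exists_prop]
    constructor
    · intro h
      obtain ⟨x', hx', e⟩ := (hF x).1
      rw [← e] at h
      by_contra! hcon
      -- Strictness for each `i` passes to the infimum because a finite nonempty family attains it;
      -- indices with `x' ∉ H i` contribute `⊤`.
      have hlt : ∀ i, y < ⨅ (_ : x' ∈ H i), (b i : ℝ≥0∞) / a i := by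
        intro i
        by_cases hi : x' ∈ H i
        · simpa [hi] using lt_of_not_ge fun h' ↦ hcon i h' ⟨x', hi, hx'⟩
        · simpa [hi] using lt_top_iff_ne_top.mpr hy
      rcases isEmpty_or_nonempty (Fin r) with hr | hr
      · rw [lam, iInf_of_empty] at h
        exact hy (top_le_iff.mp h)
      · obtain ⟨i, hi⟩ := exists_eq_ciInf_of_finite
          (f := fun i ↦ ⨅ (_ : x' ∈ H i), (b i : ℝ≥0∞) / a i)
        exact (hlt i).not_ge (hi.le.trans h)
    · rintro ⟨i, hi, x', hx', rfl⟩
      exact ((hF _).2 ⟨x', rfl, rfl⟩).trans ((iInf₂_le i hx').trans hi)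
  rw [this]
  exact (Set.toFinite _).isClosed_biUnion fun i _ ↦ π.isClosedMap _ (H i).isClosed

end Main

end ReducedOrder

theorem mainTheorem3 {k : Type u} [Field k] {X X'' X' : Scheme.{u}}
    (s : X ⟶ Spec (CommRingCat.of k)) [AlgebraicGeometry.IsIntegral X] [IsSeparated s]
    [LocallyOfFiniteType s] [QuasiCompact s]
    (I J : X.IdealSheafData)
    (f : X'' ⟶ X) (hf : ReducedOrder.IsDesingularization f)
    (g : X' ⟶ X'') {r : ℕ} (H : Fin r → Closeds X') (a b : Fin r → ℕ)
    (hg : ReducedOrder.IsLogResolution g (I.comap f) H a)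
    (ha : ∀ i, 0 < a i)
    (J' : X'.IdealSheafData)
    (hJ : J.comap (g ≫ f) = (∏ i, ReducedOrder.idealOf (H i) ^ b i) * J')
    (hJ' : ∀ i, ¬ J' ≤ ReducedOrder.idealOf (H i)) :
    (∀ x : X, IsLeast (ReducedOrder.lam H a b '' ((g ≫ f) ⁻¹' {x}))
      (ReducedOrder.muSheaf I J x)) ∧
    LowerSemicontinuous (ReducedOrder.muSheaf I J) := by
  have := hf.isProper
  have := hg.isProper
  have hI : I.comap (g ≫ f) = ∏ i, ReducedOrder.idealOf (H i) ^ a i :=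
    (I.comap_comp g f).trans hg.totalTransform
  -- The image of `X.fromSpecStalk (genericPoint X)` consists of generizations of the generic point,
  -- so it lies in every nonempty open set.
  obtain ⟨h₁, hh₁, hU₁⟩ := hf.isBirational.exists_lift (X.fromSpecStalk (genericPoint X)) (by
    rintro U hU _ ⟨y, rfl⟩
    have h1 : X.fromSpecStalk (genericPoint X) y ⤳ genericPoint X := by
      have : X.fromSpecStalk (genericPoint X) y ∈ Set.range (X.fromSpecStalk (genericPoint X)) :=
        ⟨y, rfl⟩
      rwa [Scheme.range_fromSpecStalk] at this
    have h2 : genericPoint X ⤳ X.fromSpecStalk (genericPoint X) y :=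
      (genericPoint_spec X).specializes trivial
    exact h1.mem_open U.2
      (((genericPoint_spec X).mem_open_set_iff U.2).mpr (by simpa using hU)))
  obtain ⟨h₂, hh₂, -⟩ := hg.isBirational.exists_lift h₁ hU₁
  have hh : h₂ ≫ g ≫ f = X.fromSpecStalk (genericPoint X) := by
    rw [← Category.assoc, hh₂, hh₁]
  have hπ : Function.Surjective (g ≫ f) := by
    rw [Scheme.Hom.comp_base, TopCat.coe_comp]
    exact hf.isBirational.surjective.comp hg.isBirational.surjective
  have hle (x' : X') :
      ReducedOrder.muSheaf I J ((g ≫ f) x') ≤ ReducedOrder.lam H a b x' :=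
    le_iInf₂ fun i hi ↦ ReducedOrder.muSheaf_le_div (g ≫ f) hg.isNonsingular
      hg.isSimpleNormalCrossings I J J' hI hJ (ha i) (hJ' i) hi
  have hmin (x : X) : IsLeast (ReducedOrder.lam H a b '' ((g ≫ f) ⁻¹' {x}))
      (ReducedOrder.muSheaf I J x) := by
    constructor
    · obtain ⟨x', rfl, hx'⟩ :=
        ReducedOrder.exists_muSheaf_eq_lam (g ≫ f) hπ h₂ hh I J J' ha hI hJ x
      exact ⟨x', rfl, hx'.antisymm (hle x')⟩
    · rintro _ ⟨x', rfl, rfl⟩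
      exact hle x'
  exact ⟨hmin, ReducedOrder.lowerSemicontinuous_of_isLeast (g ≫ f) hmin⟩
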